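/- Let $E$ be a Dedekind complete real vector lattice. Let $\mathcal L_{\mathrm{ob}}(E)$ denote the space of order bounded linear operators on $E$, which is a vector lattice when $S\le T$ is taken to mean that $Sx\le Tx$ for all $x\ge 0$ in $E$, and let $\mathrm{Orth}(E)\subseteq\mathcal L_{\mathrm{ob}}(E)$ denote the vector sublattice of orthomorphisms, i.e. of the order bounded operators $T$ on $E$ such that $T(B)\subseteq B$ for every band $B$ in $E$. In a vector lattice $X$, a net $(x_\alpha)_{\alpha\in A}$ is said to be order convergent to $x\in X$, denoted by $x_\alpha\xrightarrow{\mathrm o}x$, when there is a net $(y_\beta)_{\beta\in B}$ in $X$ (with a possibly different index set) such that $y_\beta\downarrow 0$ and such that, for every $\beta_0\in B$, there is an $\alpha_0\in A$ with $|x-x_\alpha|\le y_{\beta_0}$ for all $\alpha\ge\alpha_0$. Let $(T_n)$ be a sequence in $\mathrm{Orth}(E)$; it is not assumed to be order bounded. Let $S$ be a non-empty subset of $E$ such that the (order) ideal $I_S$ of $E$ that is generated by $S$ equals $E$. Then the following are equivalent: 1. $T_n\xrightarrow{\mathrm o}0$ in $\mathrm{Orth}(E)$; 2. $T_n\xrightarrow{\mathrm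 o}0$ in $\mathcal L_{\mathrm{ob}}(E)$; 3. $T_n s\xrightarrow{\mathrm o}0$ in $E$ for all $s\in S$; 4. $T_n x\xrightarrow{\mathrm o}0$ in $E$ for all $x\in E$. In particular, when $E$ has a strong order unit $e$ (i.e. $e\ge 0$ and for every $x\in E$ there is a real $\lambda\ge 0$ with $|x|\le\lambda e$), then $T_n\xrightarrow{\mathrm o}0$ in $\mathrm{Orth}(E)$ if and only if $T_n e\xrightarrow{\mathrm o}0$ in $E$. -/

import Mathlib

/-!
Vector lattices are real. Throughout, a vector lattice is given by the instances
`[AddCommGroup E] [Lattice E] [IsOrderedAddMonoid E] [Module ℝ E] [IsOrderedModule ℝ E]`; it is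
Dedekind complete (hence Archimedean) when `Lattice E` is replaced by
`ConditionallyCompleteLattice E`.
-/

universe u v w

namespace VectorLattice

section OrderConvergence

/-- Order convergence of a net `x`, indexed by `A`, to `l`: there is a net `y`, indexed by a
possibly different directed set `B`, with `y ↓ 0`, such that for every `b` eventually
`|l - x a| ≤ y b`. -/
def OrderTendsto {X : Type u} [AddCommGroup X] [Lattice X] {A : Type v} [Preorder A]
    (x : A → X) (l : X) : Prop :=
  ∃ (B : Type u) (_ : Preorder B) (_ : IsDirectedOrder B) (_ : Nonempty B) (y : B → X),
    Antitone y ∧ IsGLB (Set.range y) 0 ∧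
      ∀ b₀ : B, ∃ a₀ : A, ∀ a : A, a₀ ≤ a → |l - x a| ≤ y b₀

end OrderConvergence

section Ideals

variable {E : Type u} [AddCommGroup E] [Lattice E] [Module ℝ E]

/-- An (order) ideal: a solid linear subspace. -/
def IsIdeal (I : Submodule ℝ E) : Prop :=
  ∀ x y : E, |x| ≤ |y| → y ∈ I → x ∈ I

/-- A band: an ideal that contains the supremum of each of its non-empty subsets whose supremum
exists in the vector lattice. -/
def IsBand (B : Submodule ℝ E) : Prop :=
  IsIdeal B ∧ ∀ (A : Set E) (x : E), A ⊆ B → A.Nonempty → IsLUB A x → x ∈ B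

/-- The ideal `I_S` that is generated by `S`. -/
def idealSpan (S : Set E) : Submodule ℝ E :=
  sInf {I : Submodule ℝ E | IsIdeal I ∧ S ⊆ I}

/-- `e` is a strong order unit. -/
def IsStrongOrderUnit (e : E) : Prop :=
  0 ≤ e ∧ ∀ x : E, ∃ c : ℝ, 0 ≤ c ∧ |x| ≤ c • e

end Ideals

section Operators

variable (E : Type u) (F : Type v)
  [AddCommGroup E] [Lattice E] [Module ℝ E]
  [AddCommGroup F] [Lattice F] [IsOrderedAddMonoid F] [Module ℝ F] [IsOrderedModule ℝ F]

/-- The space of order bounded operators from `E` into `F`: the linear maps that map order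
bounded sets to order bounded sets. -/
def Lob : Submodule ℝ (E →ₗ[ℝ] F) where
  carrier := {T | ∀ A : Set E, BddAbove A → BddBelow A → BddAbove (T '' A) ∧ BddBelow (T '' A)}
  zero_mem' := by
    intro A _ _
    refine ⟨⟨0, ?_⟩, ⟨0, ?_⟩⟩ <;> rintro _ ⟨x, _, rfl⟩ <;> simp
  add_mem' := by
    intro S T hS hT A h₁ h₂
    obtain ⟨⟨a, ha⟩, ⟨b, hb⟩⟩ := hS A h₁ h₂
    obtain ⟨⟨c, hc⟩, ⟨d, hd⟩⟩ := hT A h₁ h₂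
    refine ⟨⟨a + c, ?_⟩, ⟨b + d, ?_⟩⟩ <;> rintro _ ⟨x, hx, rfl⟩
    · exact add_le_add (ha ⟨x, hx, rfl⟩) (hc ⟨x, hx, rfl⟩)
    · exact add_le_add (hb ⟨x, hx, rfl⟩) (hd ⟨x, hx, rfl⟩)
  smul_mem' := by
    intro r T hT A h₁ h₂
    obtain ⟨⟨a, ha⟩, ⟨b, hb⟩⟩ := hT A h₁ h₂
    rcases le_total 0 r with hr | hr
    · refine ⟨⟨r • a, ?_⟩, ⟨r • b, ?_⟩⟩ <;> rintro _ ⟨x, hx, rfl⟩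
      · exact smul_le_smul_of_nonneg_left (ha ⟨x, hx, rfl⟩) hr
      · exact smul_le_smul_of_nonneg_left (hb ⟨x, hx, rfl⟩) hr
    · refine ⟨⟨r • b, ?_⟩, ⟨r • a, ?_⟩⟩ <;> rintro _ ⟨x, hx, rfl⟩
      · exact smul_le_smul_of_nonpos_left (hb ⟨x, hx, rfl⟩) hr
      · exact smul_le_smul_of_nonpos_left (ha ⟨x, hx, rfl⟩) hr

end Operators

section OperatorOrder

variable {E : Type u} {F : Type v}
  [AddCommGroup E] [Lattice E] [IsOrderedAddMonoid E] [Module ℝ E]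
  [AddCommGroup F] [Lattice F] [IsOrderedAddMonoid F] [Module ℝ F] [IsOrderedModule ℝ F]

/-- The operator order: `S ≤ T` when `S x ≤ T x` for all `x ≥ 0`. -/
instance instPartialOrderLob : PartialOrder (Lob E F) where
  le S T := ∀ x : E, 0 ≤ x → S.1 x ≤ T.1 x
  le_refl _ _ _ := le_rfl
  le_trans _ _ _ h₁ h₂ x hx := (h₁ x hx).trans (h₂ x hx)
  le_antisymm S T h₁ h₂ := by
    have h : ∀ x : E, 0 ≤ x → S.1 x = T.1 x := fun x hx => le_antisymm (h₁ x hx) (h₂ x hx)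
    apply Subtype.ext
    apply LinearMap.ext
    intro x
    rw [← posPart_sub_negPart x, map_sub, map_sub, h _ (posPart_nonneg x), h _ (negPart_nonneg x)]

theorem Lob.le_def (S T : Lob E F) : S ≤ T ↔ ∀ x : E, 0 ≤ x → S.1 x ≤ T.1 x := Iff.rfl

instance instIsOrderedAddMonoidLob : IsOrderedAddMonoid (Lob E F) where
  add_le_add_left _ _ h _ := fun x hx => by
    simpa using h x hx

instance instIsOrderedModuleLob : IsOrderedModule ℝ (Lob E F) where
  smul_le_smul_of_nonneg_left _ hr _ _ h := fun x hx =>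
    smul_le_smul_of_nonneg_left (h x hx) hr
  smul_le_smul_of_nonneg_right S hS _ _ hrt := fun x hx =>
    smul_le_smul_of_nonneg_right hrt (show (0 : F) ≤ S.1 x from hS x hx)

end OperatorOrder

section RieszKantorovich

/-- A partially ordered abelian group in which positive parts exist is a lattice, with the given
order. -/
noncomputable abbrev latticeOfPosPart {X : Type u} [AddCommGroup X] [PartialOrder X]
    [IsOrderedAddMonoid X] (h : ∀ x : X, ∃ p, IsLUB {x, 0} p) : Lattice X where
  sup a b := b + (h (a - b)).choose
  inf a b := a - (h (a - b)).choose
  le_sup_left a b := by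
    have := (h (a - b)).choose_spec.1 (Set.mem_insert _ _)
    exact sub_le_iff_le_add'.1 this
  le_sup_right a b := by
    have := (h (a - b)).choose_spec.1 (Set.mem_insert_of_mem _ rfl)
    exact le_add_of_nonneg_right this
  sup_le a b c hac hbc := by
    have : (h (a - b)).choose ≤ c - b := by
      refine (h (a - b)).choose_spec.2 ?_
      rintro _ (rfl | rfl)
      · exact sub_le_sub_right hac b
      · exact sub_nonneg.2 hbc
    exact le_sub_iff_add_le'.1 this
  inf_le_left a b := by
    have := (h (a - b)).choose_spec.1 (Set.mem_insert_of_mem _ rfl)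
    exact sub_le_self a this
  inf_le_right a b := by
    have := (h (a - b)).choose_spec.1 (Set.mem_insert _ _)
    exact sub_le_comm.1 this
  le_inf a b c hab hac := by
    have : (h (b - c)).choose ≤ b - a := by
      refine (h (b - c)).choose_spec.2 ?_
      rintro _ (rfl | rfl)
      · exact sub_le_sub_left hac b
      · exact sub_nonneg.2 hab
    exact le_sub_comm.1 this

variable {E : Type u} {F : Type v}
  [AddCommGroup E] [Lattice E] [IsOrderedAddMonoid E] [Module ℝ E] [IsOrderedModule ℝ E]
  [AddCommGroup F] [ConditionallyCompleteLattice F] [IsOrderedAddMonoid F] [Module ℝ F]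
  [IsOrderedModule ℝ F]

/-- An additive and positively homogeneous map on the positive cone extends to a linear map. -/
theorem exists_linear_extension (p : E → F)
    (hadd : ∀ x y, 0 ≤ x → 0 ≤ y → p (x + y) = p x + p y)
    (hsmul : ∀ (c : ℝ) x, 0 < c → 0 ≤ x → p (c • x) = c • p x) :
    ∃ P : E →ₗ[ℝ] F, ∀ x, 0 ≤ x → P x = p x := by
  have h0 : p 0 = 0 := by
    have := hadd 0 0 le_rfl le_rfl
    simpa using this
  have key : ∀ x a b : E, 0 ≤ a → 0 ≤ b → x = a - b → p (x⁺) - p (x⁻) = p a - p b := by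
    intro x a b ha hb hx
    have h1 : x⁺ + b = a + x⁻ := by
      have := posPart_sub_negPart x
      rw [hx] at this ⊢
      rw [sub_eq_sub_iff_add_eq_add] at this
      exact this
    have h2 := congrArg p h1
    rw [hadd _ _ (posPart_nonneg x) hb, hadd _ _ ha (negPart_nonneg x)] at h2
    rw [sub_eq_sub_iff_add_eq_add]
    exact h2
  have dec : ∀ x : E, x = x⁺ - x⁻ := fun x => (posPart_sub_negPart x).symm
  refine ⟨{ toFun := fun x => p (x⁺) - p (x⁻), map_add' := ?_, map_smul' := ?_ }, ?_⟩
  · intro x y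
    rw [key (x + y) (x⁺ + y⁺) (x⁻ + y⁻) (add_nonneg (posPart_nonneg x) (posPart_nonneg y))
      (add_nonneg (negPart_nonneg x) (negPart_nonneg y))
      (by rw [add_sub_add_comm, ← dec, ← dec]),
      hadd _ _ (posPart_nonneg x) (posPart_nonneg y),
      hadd _ _ (negPart_nonneg x) (negPart_nonneg y), add_sub_add_comm]
  · intro c x
    rw [RingHom.id_apply]
    rcases lt_trichotomy c 0 with hc | rfl | hc
    · have hc' : 0 < -c := neg_pos.2 hc
      rw [key (c • x) ((-c) • x⁻) ((-c) • x⁺) (smul_nonneg hc'.le (negPart_nonneg x))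
        (smul_nonneg hc'.le (posPart_nonneg x))
        (by
          conv_lhs => rw [dec x]
          rw [← smul_sub, neg_smul, ← smul_neg, neg_sub]),
        hsmul _ _ hc' (negPart_nonneg x), hsmul _ _ hc' (posPart_nonneg x), ← smul_sub, neg_smul,
        ← smul_neg, neg_sub]
    · simp
    · rw [key (c • x) (c • x⁺) (c • x⁻) (smul_nonneg hc.le (posPart_nonneg x))
        (smul_nonneg hc.le (negPart_nonneg x)) (by rw [← smul_sub, ← dec]),
        hsmul _ _ hc (posPart_nonneg x), hsmul _ _ hc (negPart_nonneg x), smul_sub]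
  · intro x hx
    simp [posPart_of_nonneg hx, negPart_of_nonneg hx, h0]

/-- The Riesz–Kantorovich formula: `T` has a positive part `P` in the order bounded operators, and
`P x = sup {T y : 0 ≤ y ≤ x}` for `x ≥ 0`. -/
theorem exists_posPart_Lob (T : Lob E F) :
    ∃ P : Lob E F, IsLUB {T, 0} P ∧ ∀ x, 0 ≤ x → IsLUB (T.1 '' Set.Icc 0 x) (P.1 x) := by
  set p : E → F := fun x => sSup (T.1 '' Set.Icc 0 x) with hp
  have hlub : ∀ x, 0 ≤ x → IsLUB (T.1 '' Set.Icc 0 x) (p x) := fun x hx =>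
    isLUB_csSup ((Set.nonempty_Icc.2 hx).image _) (T.2 _ bddAbove_Icc bddBelow_Icc).1
  have hmem : ∀ x y, 0 ≤ y → y ≤ x → T.1 y ≤ p x := fun x y hy hyx =>
    (hlub x (hy.trans hyx)).1 ⟨y, ⟨hy, hyx⟩, rfl⟩
  have hle : ∀ x c, 0 ≤ x → (∀ y, 0 ≤ y → y ≤ x → T.1 y ≤ c) → p x ≤ c := by
    intro x c hx h
    refine (hlub x hx).2 ?_
    rintro _ ⟨y, hy, rfl⟩
    exact h y hy.1 hy.2
  have hadd : ∀ x y, 0 ≤ x → 0 ≤ y → p (x + y) = p x + p y := by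
    intro x y hx hy
    apply le_antisymm
    · refine hle _ _ (add_nonneg hx hy) fun z hz hzxy => ?_
      have h1 : T.1 z = T.1 (z ⊓ x) + T.1 (z - z ⊓ x) := by rw [← map_add]; simp
      rw [h1]
      refine add_le_add (hmem _ _ (le_inf hz hx) inf_le_right)
        (hmem _ _ (sub_nonneg.2 inf_le_left) ?_)
      rw [sub_le_iff_le_add', ← sub_le_iff_le_add]
      refine le_inf (sub_le_self z hy) (sub_le_iff_le_add.2 hzxy)
    · rw [← le_sub_iff_add_le]
      refine hle _ _ hx fun a ha hax => ?_
      rw [le_sub_comm]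
      refine hle _ _ hy fun b hb hby => ?_
      rw [le_sub_iff_add_le', ← map_add]
      exact hmem _ _ (add_nonneg ha hb) (add_le_add hax hby)
  have hsmul_le : ∀ (c : ℝ) x, 0 < c → 0 ≤ x → p (c • x) ≤ c • p x := by
    intro c x hc hx
    refine hle _ _ (smul_nonneg hc.le hx) fun y hy hyx => ?_
    have h1 : T.1 y = c • T.1 (c⁻¹ • y) := by rw [← map_smul, smul_inv_smul₀ hc.ne']
    rw [h1]
    refine smul_le_smul_of_nonneg_left (hmem _ _ (smul_nonneg (inv_pos.2 hc).le hy) ?_) hc.le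
    have := smul_le_smul_of_nonneg_left hyx (inv_pos.2 hc).le
    rwa [inv_smul_smul₀ hc.ne'] at this
  have hsmul : ∀ (c : ℝ) x, 0 < c → 0 ≤ x → p (c • x) = c • p x := by
    intro c x hc hx
    apply le_antisymm (hsmul_le c x hc hx)
    have h1 := hsmul_le c⁻¹ (c • x) (inv_pos.2 hc) (smul_nonneg hc.le hx)
    rw [inv_smul_smul₀ hc.ne'] at h1
    have := smul_le_smul_of_nonneg_left h1 hc.le
    rwa [smul_inv_smul₀ hc.ne'] at this
  obtain ⟨P, hP⟩ := exists_linear_extension p hadd hsmul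
  have hPpos : ∀ x, 0 ≤ x → 0 ≤ P x := fun x hx => by
    rw [hP x hx]
    have := hmem x 0 le_rfl hx
    rwa [map_zero] at this
  have hPmono : ∀ x y, x ≤ y → P x ≤ P y := fun x y hxy => by
    have := hPpos (y - x) (sub_nonneg.2 hxy)
    rwa [map_sub, sub_nonneg] at this
  have hPob : P ∈ Lob E F := by
    rintro A ⟨a, ha⟩ ⟨b, hb⟩
    refine ⟨⟨P a, ?_⟩, ⟨P b, ?_⟩⟩ <;> rintro _ ⟨x, hx, rfl⟩
    · exact hPmono _ _ (ha hx)
    · exact hPmono _ _ (hb hx)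
  refine ⟨⟨P, hPob⟩, ⟨?_, ?_⟩, ?_⟩
  · rintro R (rfl | rfl) x hx
    · change R.1 x ≤ P x
      rw [hP x hx]
      exact hmem x x hx le_rfl
    · exact hPpos x hx
  · intro R hR x hx
    change P x ≤ R.1 x
    rw [hP x hx]
    have hR0 : (0 : Lob E F) ≤ R := hR (Set.mem_insert_of_mem _ rfl)
    have hRT : T ≤ R := hR (Set.mem_insert _ _)
    refine hle _ _ hx fun y hy hyx => (hRT y hy).trans ?_
    have : (0 : F) ≤ R.1 (x - y) := hR0 (x - y) (sub_nonneg.2 hyx)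
    rw [map_sub] at this
    exact sub_nonneg.1 this
  · intro x hx
    change IsLUB _ (P x)
    rw [hP x hx]
    exact hlub x hx

/-- For Dedekind complete `F`, the order bounded operators from `E` into `F` form a vector lattice
in the operator order. -/
noncomputable instance instLatticeLob : Lattice (Lob E F) :=
  latticeOfPosPart (X := Lob E F) fun T => (exists_posPart_Lob T).imp fun _ h => h.1

end RieszKantorovich

section Orthomorphisms

variable (E : Type u)

/-- The orthomorphisms on `E`: the order bounded operators that map every band into itself. As a
subspace of `Lob E E`, it carries the operator order. -/
def Orth [AddCommGroup E] [Lattice E] [IsOrderedAddMonoid E] [Module ℝ E] [IsOrderedModule ℝ E] :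
    Submodule ℝ (Lob E E) where
  carrier := {T | ∀ B : Submodule ℝ E, IsBand B → ∀ x ∈ B, T.1 x ∈ B}
  zero_mem' := fun B _ _ _ => B.zero_mem
  add_mem' := fun hS hT B hB x hx => B.add_mem (hS B hB x hx) (hT B hB x hx)
  smul_mem' := fun r _ hT B hB x hx => B.smul_mem r (hT B hB x hx)

variable {E}

section

variable [AddCommGroup E] [Lattice E] [IsOrderedAddMonoid E] [Module ℝ E] [IsOrderedModule ℝ E]

/-- The order on the orthomorphisms is the operator order. -/
instance instPartialOrderOrth : PartialOrder (Orth E) :=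
  PartialOrder.lift (fun T : Orth E => (T : Lob E E)) Subtype.val_injective

theorem Orth.le_def (S T : Orth E) : S ≤ T ↔ (S : Lob E E) ≤ (T : Lob E E) := Iff.rfl

instance instIsOrderedAddMonoidOrth : IsOrderedAddMonoid (Orth E) where
  add_le_add_left _ _ h R := by
    rw [Orth.le_def] at h ⊢
    exact add_le_add_left h (R : Lob E E)

instance instIsOrderedModuleOrth : IsOrderedModule ℝ (Orth E) where
  smul_le_smul_of_nonneg_left _ hr _ _ h := by
    rw [Orth.le_def] at h ⊢
    exact smul_le_smul_of_nonneg_left h hr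
  smul_le_smul_of_nonneg_right _ hS _ _ hrt := by
    rw [Orth.le_def] at hS ⊢
    exact smul_le_smul_of_nonneg_right hrt hS

end

variable [AddCommGroup E] [ConditionallyCompleteLattice E] [IsOrderedAddMonoid E] [Module ℝ E]
  [IsOrderedModule ℝ E]

theorem exists_posPart_Orth (T : Orth E) : ∃ P : Orth E, IsLUB {T, 0} P := by
  obtain ⟨P, hP, hf⟩ := exists_posPart_Lob T.1
  have hpos : ∀ B : Submodule ℝ E, IsBand B → ∀ x ∈ B, 0 ≤ x → P.1 x ∈ B := by
    intro B hB x hx h0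
    refine hB.2 _ _ ?_ ((Set.nonempty_Icc.2 h0).image _) (hf x h0)
    rintro _ ⟨y, hy, rfl⟩
    refine T.2 B hB y (hB.1 y x ?_ hx)
    rw [abs_of_nonneg hy.1, abs_of_nonneg h0]
    exact hy.2
  have hPO : P ∈ Orth E := by
    intro B hB x hx
    rw [← posPart_sub_negPart x, map_sub]
    refine B.sub_mem (hpos B hB _ (hB.1 _ x ?_ hx) (posPart_nonneg x))
      (hpos B hB _ (hB.1 _ x ?_ hx) (negPart_nonneg x))
    · rw [abs_of_nonneg (posPart_nonneg x)]
      exact sup_le (le_abs_self x) (abs_nonneg x)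
    · rw [abs_of_nonneg (negPart_nonneg x)]
      exact sup_le (neg_le_abs x) (abs_nonneg x)
  have hTP : T.1 ≤ P := hP.1 (Set.mem_insert _ _)
  have h0P : (0 : Lob E E) ≤ P := hP.1 (Set.mem_insert_of_mem _ rfl)
  refine ⟨⟨P, hPO⟩, ?_, ?_⟩
  · intro R hR
    rcases hR with hR | hR
    · rw [hR]
      exact hTP
    · rw [Set.mem_singleton_iff.1 hR]
      exact h0P
  · intro R hR
    have hTR : T.1 ≤ R.1 := hR (Set.mem_insert _ _)
    have h0R : (0 : Lob E E) ≤ R.1 := hR (Set.mem_insert_of_mem _ rfl)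
    have hPR : P ≤ R.1 := hP.2 (by
      intro Q hQ
      rcases hQ with hQ | hQ
      · rw [hQ]
        exact hTR
      · rw [Set.mem_singleton_iff.1 hQ]
        exact h0R)
    exact hPR

/-- The orthomorphisms form a vector lattice in the operator order. -/
noncomputable instance instLatticeOrth : Lattice (Orth E) :=
  latticeOfPosPart (X := Orth E) exists_posPart_Orth

end Orthomorphisms

end VectorLattice

/-!
Since an orthomorphism preserves bands, in particular disjoint complements, it preserves
disjointness. Combined with the Riesz–Kantorovich formula this shows that the lattice operations of
`Orth E` are pointwise on the positive cone, and that `|T| |x| = |T x|` for all `x`.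

By the latter, the set of all `x` for which `T n x` is order convergent to `0` is an ideal, so it is
all of `E` as soon as it contains a set that generates `E` as an ideal. When it is all of `E`, the
sequence is pointwise order bounded, and the pointwise suprema of the tails `|T m|`, `m ≥ n`, are
superadditive because `S x ⊔ T x = (S ⊔ T) x`. They are therefore the values of orthomorphisms,
which decrease to `0` and dominate `|T n|`. In the other direction, `Orth E` is an ideal of
`Lob E E`, so that infima `0` of decreasing nets are the same in both, and in `Lob E E` such infima
are pointwise.
-/

namespace VectorLattice

section LatticeOrderedGroup

variable {E : Type u} [AddCommGroup E] [Lattice E] [IsOrderedAddMonoid E] {a b u : E}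

theorem add_inf_le_inf_add_inf (ha : 0 ≤ a) (hb : 0 ≤ b) (hu : 0 ≤ u) :
    (a + b) ⊓ u ≤ a ⊓ u + b ⊓ u := by
  rw [add_inf, inf_add, inf_add]
  refine le_inf (le_inf inf_le_left ?_) (le_inf ?_ ?_)
  · exact inf_le_right.trans (le_add_of_nonneg_right hb)
  · exact inf_le_right.trans (le_add_of_nonneg_left ha)
  · exact inf_le_right.trans (le_add_of_nonneg_right hu)

theorem abs_sub_le_abs_add_abs (a b : E) : |a - b| ≤ |a| + |b| := by
  rw [sub_eq_add_neg, ← abs_neg b]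
  exact abs_add_le a (-b)

theorem abs_sub_eq_add_of_abs_inf_abs_eq_zero (h : |a| ⊓ |b| = 0) : |a - b| = |a| + |b| := by
  have hsub : |(|b| - |a|)| = |a| + |b| := by
    rw [← sup_sub_inf_eq_abs_sub, ← inf_add_sup |a| |b|, h, sub_zero, zero_add]
  refine le_antisymm (abs_sub_le_abs_add_abs a b) ?_
  rw [← hsub, abs_sub_comm a]
  exact abs_abs_sub_abs_le b a

theorem posPart_sub_eq_of_inf_eq_zero (h : a ⊓ b = 0) : (a - b)⁺ = a := by
  have := inf_add_sup a b
  rw [h, zero_add, sup_eq_add_posPart_sub, add_comm] at this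
  exact add_right_cancel this

theorem isLUB_image_inf {A : Set E} (h : IsLUB A a) (u : E) :
    IsLUB ((· ⊓ u) '' A) (a ⊓ u) := by
  refine ⟨?_, fun c hc => ?_⟩
  · rintro _ ⟨z, hz, rfl⟩
    exact inf_le_inf_right u (h.1 hz)
  · have hbound : a ≤ c + (a ⊔ u) - u := h.2 fun z hz => by
      rw [le_sub_iff_add_le, ← inf_add_sup z u]
      exact add_le_add (hc ⟨z, hz, rfl⟩) (sup_le_sup_right (h.1 hz) u)
    rwa [le_sub_iff_add_le, ← inf_add_sup a u, add_le_add_iff_right] at hbound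

end LatticeOrderedGroup

section Ideals

variable {E : Type u} [AddCommGroup E] [Lattice E] [Module ℝ E] {I : Submodule ℝ E} {x y : E}

theorem IsIdeal.idealSpan_le {S : Set E} (hI : IsIdeal I) (hS : S ⊆ I) : idealSpan S ≤ I :=
  sInf_le ⟨hI, hS⟩

theorem IsStrongOrderUnit.idealSpan_eq_top {e : E} (he : IsStrongOrderUnit e) :
    idealSpan {e} = ⊤ := by
  refine Submodule.eq_top_iff'.2 fun x => Submodule.mem_sInf.2 fun I ⟨hI, heI⟩ => ?_
  obtain ⟨c, -, hxc⟩ := he.2 x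
  exact hI x (c • e) (hxc.trans (le_abs_self _)) (I.smul_mem c (heI rfl))

variable [IsOrderedAddMonoid E]

theorem IsIdeal.mem_of_nonneg_of_le (hI : IsIdeal I) (hx : 0 ≤ x) (hxy : x ≤ y) (hy : y ∈ I) :
    x ∈ I :=
  hI x y (by rwa [abs_of_nonneg hx, abs_of_nonneg (hx.trans hxy)]) hy

theorem IsIdeal.posPart_mem (hI : IsIdeal I) (hx : x ∈ I) : x⁺ ∈ I :=
  hI _ x (by rw [abs_of_nonneg (posPart_nonneg x)]; exact sup_le (le_abs_self x) (abs_nonneg x)) hx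

theorem IsIdeal.negPart_mem (hI : IsIdeal I) (hx : x ∈ I) : x⁻ ∈ I :=
  hI _ x (by rw [abs_of_nonneg (negPart_nonneg x)]; exact sup_le (neg_le_abs x) (abs_nonneg x)) hx

end Ideals

theorem abs_smul_le {E : Type u} [AddCommGroup E] [Lattice E] [Module ℝ E]
    [IsOrderedModule ℝ E] (c : ℝ) (x : E) : |c • x| ≤ |c| • |x| := by
  have h (t : ℝ) : t • x ≤ |t| • |x| := by
    rcases abs_cases t with ⟨ht, h0⟩ | ⟨ht, h0⟩
    · rw [ht]
      exact smul_le_smul_of_nonneg_left (le_abs_self x) h0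
    · rw [ht, ← neg_smul_neg t x]
      exact smul_le_smul_of_nonneg_left (neg_le_abs x) (neg_nonneg.2 h0.le)
  refine abs_le'.2 ⟨h c, ?_⟩
  rw [← neg_smul, ← abs_neg c]
  exact h (-c)

section DisjointComplement

variable {E : Type u} [AddCommGroup E] [Lattice E] [IsOrderedAddMonoid E] [Module ℝ E]
  [IsOrderedModule ℝ E] {x y u : E}

theorem smul_inf_eq_zero {c : ℝ} (hc : 0 ≤ c) (h : x ⊓ u = 0) : (c • x) ⊓ u = 0 := by
  have hx : 0 ≤ x := h ▸ inf_le_left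
  have hu : 0 ≤ u := h ▸ inf_le_right
  have ht : 0 < c + 1 := by positivity
  refine le_antisymm ?_ (le_inf (smul_nonneg hc hx) hu)
  have hle : (c + 1)⁻¹ • ((c • x) ⊓ u) ≤ x ⊓ u := by
    refine le_inf ((inv_smul_le_iff_of_pos ht).2 ?_) ((inv_smul_le_iff_of_pos ht).2 ?_)
    · exact inf_le_left.trans (smul_le_smul_of_nonneg_right (by linarith) hx)
    · exact inf_le_right.trans (le_smul_of_one_le_left hu (by linarith))
  rwa [h, inv_smul_le_iff_of_pos ht, smul_zero] at hle

/-- The disjoint complement `{u}ᵈ`: the elements `x` that are disjoint from `u`, i.e. for which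
`|x| ∧ |u| = 0`. -/
def disjointComplement (u : E) : Submodule ℝ E where
  carrier := {x | |x| ⊓ |u| = 0}
  zero_mem' := by simp
  add_mem' {x y} hx hy := by
    refine le_antisymm ?_ (le_inf (abs_nonneg _) (abs_nonneg _))
    calc |x + y| ⊓ |u| ≤ (|x| + |y|) ⊓ |u| := inf_le_inf_right _ (abs_add_le x y)
      _ ≤ |x| ⊓ |u| + |y| ⊓ |u| :=
        add_inf_le_inf_add_inf (abs_nonneg x) (abs_nonneg y) (abs_nonneg u)
      _ = 0 := by rw [hx, hy, add_zero]
  smul_mem' c x hx := by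
    refine le_antisymm ?_ (le_inf (abs_nonneg _) (abs_nonneg _))
    calc |c • x| ⊓ |u| ≤ (|c| • |x|) ⊓ |u| := inf_le_inf_right _ (abs_smul_le c x)
      _ = 0 := smul_inf_eq_zero (abs_nonneg c) hx

theorem mem_disjointComplement : x ∈ disjointComplement u ↔ |x| ⊓ |u| = 0 := Iff.rfl

theorem isIdeal_disjointComplement (u : E) : IsIdeal (disjointComplement u) :=
  fun x _ hxy hy =>
    le_antisymm ((inf_le_inf_right _ hxy).trans_eq hy) (le_inf (abs_nonneg x) (abs_nonneg u))

theorem isBand_disjointComplement (u : E) : IsBand (disjointComplement u) := by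
  refine ⟨isIdeal_disjointComplement u, fun A x hA ⟨a, ha⟩ hx => ?_⟩
  let : DistribLattice E := AddCommGroup.toDistribLattice E
  have hinf : x ⊓ |u| ≤ 0 := by
    refine (isLUB_image_inf hx |u|).2 ?_
    rintro _ ⟨z, hz, rfl⟩
    exact (inf_le_inf_right _ (le_abs_self z)).trans_eq (hA hz)
  have habs : |x| ≤ x ⊔ |a| :=
    sup_le le_sup_left (((neg_le_neg (hx.1 ha)).trans (neg_le_abs a)).trans le_sup_right)
  refine le_antisymm ?_ (le_inf (abs_nonneg x) (abs_nonneg u))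
  calc |x| ⊓ |u| ≤ (x ⊔ |a|) ⊓ |u| := inf_le_inf_right _ habs
    _ = x ⊓ |u| ⊔ |a| ⊓ |u| := inf_sup_right _ _ _
    _ ≤ 0 := sup_le hinf (hA ha).le

end DisjointComplement

section OrderConvergence

variable {X : Type u} [AddCommGroup X] [Lattice X] {A : Type v} [Preorder A] {x y : A → X} {l : X}

theorem orderTendsto_of_antitone {B : Type w} [Preorder B] [IsDirectedOrder B] [Nonempty B]
    {z : B → X} (hz : Antitone z) (hz0 : IsGLB (Set.range z) 0)
    (h : ∀ b, ∃ a₀, ∀ a, a₀ ≤ a → |l - x a| ≤ z b) : OrderTendsto x l := by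
  -- The net of values of `z`, ordered downwards, is indexed by a type in the universe of `X`.
  refine ⟨(Set.range z)ᵒᵈ, inferInstance, ⟨?_⟩, ?_, fun b => (OrderDual.ofDual b).1,
    fun _ _ hbc => hbc, ?_, ?_⟩
  · rintro ⟨_, b, rfl⟩ ⟨_, c, rfl⟩
    obtain ⟨d, hbd, hcd⟩ := exists_ge_ge b c
    exact ⟨⟨z d, d, rfl⟩, hz hbd, hz hcd⟩
  · exact (Set.range_nonempty z).to_subtype
  · rwa [show Set.range (fun b : (Set.range z)ᵒᵈ => (OrderDual.ofDual b).1) = Set.range z from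
      Subtype.range_coe]
  · rintro ⟨_, b, rfl⟩
    exact h b

theorem orderTendsto_zero_iff : OrderTendsto x 0 ↔
    ∃ (B : Type u) (_ : Preorder B) (_ : IsDirectedOrder B) (_ : Nonempty B) (y : B → X),
      Antitone y ∧ IsGLB (Set.range y) 0 ∧ ∀ b, ∃ a₀, ∀ a, a₀ ≤ a → |x a| ≤ y b := by
  simp only [OrderTendsto, zero_sub, abs_neg]

theorem orderTendsto_zero_of_antitone {B : Type w} [Preorder B] [IsDirectedOrder B] [Nonempty B]
    {z : B → X} (hz : Antitone z) (hz0 : IsGLB (Set.range z) 0)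
    (h : ∀ b, ∃ a₀, ∀ a, a₀ ≤ a → |x a| ≤ z b) : OrderTendsto x 0 :=
  orderTendsto_of_antitone hz hz0 (by simpa only [zero_sub, abs_neg] using h)

theorem OrderTendsto.of_abs_le_abs (hy : OrderTendsto y 0) (h : ∀ a, |x a| ≤ |y a|) :
    OrderTendsto x 0 := by
  obtain ⟨B, _, _, _, z, hz, hz0, hyz⟩ := orderTendsto_zero_iff.1 hy
  exact orderTendsto_zero_of_antitone hz hz0 fun b =>
    (hyz b).imp fun _ ha₀ a ha => (h a).trans (ha₀ a ha)

variable [IsOrderedAddMonoid X]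

theorem orderTendsto_const [Nonempty A] (l : X) : OrderTendsto (fun _ : A => l) l :=
  orderTendsto_of_antitone (B := Unit) (z := fun _ => 0) antitone_const (by simp)
    fun _ => ⟨Classical.arbitrary A, fun _ _ => by simp⟩

theorem OrderTendsto.bddAbove_range_abs {x : ℕ → X} (h : OrderTendsto x l) :
    BddAbove (Set.range fun n => |x n|) := by
  obtain ⟨B, _, _, ⟨b⟩, y, -, -, hxy⟩ := h
  obtain ⟨N, hN⟩ := hxy b
  obtain ⟨M, hM⟩ := ((Set.finite_Iio N).image fun n => |x n|).bddAbove
  refine ⟨M ⊔ (|l| + y b), ?_⟩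
  rintro _ ⟨n, rfl⟩
  rcases lt_or_ge n N with hn | hn
  · exact (hM ⟨n, hn, rfl⟩).trans le_sup_left
  · refine le_sup_of_le_right ?_
    calc |x n| = |l - (l - x n)| := by rw [sub_sub_cancel]
      _ ≤ |l| + |l - x n| := abs_sub_le_abs_add_abs l (l - x n)
      _ ≤ |l| + y b := add_le_add_right (hN n hn) _

theorem OrderTendsto.add [IsDirectedOrder A] {k : X} (hx : OrderTendsto x k)
    (hy : OrderTendsto y l) : OrderTendsto (fun a => x a + y a) (k + l) := by
  obtain ⟨B, _, _, _, z, hz, hz0, hxz⟩ := hx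
  obtain ⟨C, _, _, _, w, hw, hw0, hyw⟩ := hy
  have : IsDirectedOrder (B × C) := ⟨fun p q =>
    have ⟨b, hpb, hqb⟩ := exists_ge_ge p.1 q.1
    have ⟨c, hpc, hqc⟩ := exists_ge_ge p.2 q.2
    ⟨(b, c), ⟨hpb, hpc⟩, hqb, hqc⟩⟩
  have hanti : Antitone fun p : B × C => z p.1 + w p.2 := fun _ _ hpq =>
    add_le_add (hz hpq.1) (hw hpq.2)
  refine orderTendsto_of_antitone hanti ?_ fun p => ?_
  · have := hz0.add hw0
    rwa [← Set.image2_add, Set.image2_range, add_zero] at this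
  · obtain ⟨a₁, h₁⟩ := hxz p.1
    obtain ⟨a₂, h₂⟩ := hyw p.2
    obtain ⟨a₀, h₁₀, h₂₀⟩ := exists_ge_ge a₁ a₂
    refine ⟨a₀, fun a ha => ?_⟩
    rw [add_sub_add_comm]
    exact (abs_add_le _ _).trans (add_le_add (h₁ a (h₁₀.trans ha)) (h₂ a (h₂₀.trans ha)))

theorem OrderTendsto.const_smul [Module ℝ X] [IsOrderedModule ℝ X] (hx : OrderTendsto x l)
    (c : ℝ) : OrderTendsto (fun a => c • x a) (c • l) := by
  obtain ⟨B, _, _, _, z, hz, hz0, hxz⟩ := hx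
  have ht : 0 < |c| + 1 := by positivity
  refine ⟨B, _, ‹_›, ‹_›, fun b => (|c| + 1) • z b,
    fun _ _ hbd => smul_le_smul_of_nonneg_left (hz hbd) ht.le, ?_, fun b => ?_⟩
  · have := (OrderIso.smulRight (β := X) ht).isGLB_image'.2 hz0
    rwa [← Set.range_comp, OrderIso.smulRight_apply, smul_zero] at this
  · refine (hxz b).imp fun a₀ ha₀ a ha => ?_
    rw [← smul_sub]
    calc |c • (l - x a)| ≤ |c| • |l - x a| := abs_smul_le c _
      _ ≤ (|c| + 1) • |l - x a| :=
        smul_le_smul_of_nonneg_right (le_add_of_nonneg_right zero_le_one) (abs_nonneg _)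
      _ ≤ (|c| + 1) • z b := smul_le_smul_of_nonneg_left (ha₀ a ha) ht.le

/-- The subspace of all `x` for which the net `T a x` is order convergent to `0`. -/
def nullSubmodule {E : Type w} [AddCommGroup E] [Module ℝ E] [Module ℝ X] [IsOrderedModule ℝ X]
    [IsDirectedOrder A] [Nonempty A] (T : A → E →ₗ[ℝ] X) : Submodule ℝ E where
  carrier := {x | OrderTendsto (fun a => T a x) 0}
  zero_mem' := by simpa using orderTendsto_const (A := A) (0 : X)
  add_mem' hx hy := by simpa using OrderTendsto.add hx hy
  smul_mem' c x hx := by simpa using OrderTendsto.const_smul hx c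

theorem mem_nullSubmodule {E : Type w} [AddCommGroup E] [Module ℝ E] [Module ℝ X]
    [IsOrderedModule ℝ X] [IsDirectedOrder A] [Nonempty A] {T : A → E →ₗ[ℝ] X} {x : E} :
    x ∈ nullSubmodule T ↔ OrderTendsto (fun a => T a x) 0 :=
  Iff.rfl

end OrderConvergence

section OrderBoundedOperators

variable {E : Type u} {F : Type v} [AddCommGroup E] [Lattice E] [Module ℝ E] [AddCommGroup F]
  [Lattice F] [IsOrderedAddMonoid F] [Module ℝ F] [IsOrderedModule ℝ F]

theorem Lob.mem_of_monotone {T : E →ₗ[ℝ] F} (hT : Monotone T) : T ∈ Lob E F :=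
  fun _ ha hb => ⟨hT.map_bddAbove ha, hT.map_bddBelow hb⟩

theorem Lob.monotone_of_nonneg [IsOrderedAddMonoid E] {T : Lob E F} (hT : 0 ≤ T) : Monotone T.1 :=
  (monotone_iff_map_nonneg T.1).2 hT

end OrderBoundedOperators

section RieszKantorovich

variable {E : Type u} {F : Type v} [AddCommGroup E] [Lattice E] [IsOrderedAddMonoid E]
  [Module ℝ E] [IsOrderedModule ℝ E] [AddCommGroup F] [ConditionallyCompleteLattice F]
  [IsOrderedAddMonoid F] [Module ℝ F] [IsOrderedModule ℝ F] {ι : Type w} {x : E}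

theorem Lob.isLUB_posPart_apply (T : Lob E F) (hx : 0 ≤ x) :
    IsLUB (T.1 '' Set.Icc 0 x) (T⁺.1 x) := by
  obtain ⟨P, hP, hPx⟩ := exists_posPart_Lob T
  rw [show T⁺ = P from isLUB_pair.unique hP]
  exact hPx x hx

theorem Lob.abs_apply_le (T : Lob E F) (x : E) : |T.1 x| ≤ |T|.1 |x| := by
  have habs {z : E} (hz : 0 ≤ z) : |T.1 z| ≤ |T|.1 z :=
    abs_le'.2 ⟨le_abs_self T z hz, neg_le_abs T z hz⟩
  calc |T.1 x| = |T.1 x⁺ - T.1 x⁻| := by rw [← map_sub, posPart_sub_negPart]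
    _ ≤ |T.1 x⁺| + |T.1 x⁻| := abs_sub_le_abs_add_abs _ _
    _ ≤ |T|.1 x⁺ + |T|.1 x⁻ := add_le_add (habs (posPart_nonneg x)) (habs (negPart_nonneg x))
    _ = |T|.1 |x| := by rw [← map_add, posPart_add_negPart]

theorem Lob.exists_isLUB_apply [Nonempty ι] {f : ι → Lob E F}
    (hbdd : ∀ x, 0 ≤ x → BddAbove (Set.range fun i => (f i).1 x))
    (hadd : ∀ x y, 0 ≤ x → 0 ≤ y → ∀ i j, (f i).1 x + (f j).1 y ≤ ⨆ k, (f k).1 (x + y)) :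
    ∃ P : Lob E F, ∀ x, 0 ≤ x → IsLUB (Set.range fun i => (f i).1 x) (P.1 x) := by
  obtain ⟨P, hP⟩ := exists_linear_extension (fun x : E => ⨆ i, (f i).1 x)
    (fun x y hx hy => by
      refine le_antisymm (ciSup_le fun i => ?_) (ciSup_add_ciSup_le (hadd x y hx hy))
      rw [map_add]
      exact add_le_add (le_ciSup (hbdd x hx) i) (le_ciSup (hbdd y hy) i))
    (fun c x hc hx => by
      simp only [map_smul]
      exact ((OrderIso.smulRight hc).map_ciSup (hbdd x hx)).symm)
  have hPx (x : E) (hx : 0 ≤ x) : IsLUB (Set.range fun i => (f i).1 x) (P x) := by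
    rw [hP x hx]
    exact isLUB_ciSup (hbdd x hx)
  let i := Classical.arbitrary ι
  have hPi : P - (f i).1 ∈ Lob E F := Lob.mem_of_monotone <| (monotone_iff_map_nonneg _).2
    fun x hx => sub_nonneg.2 ((hPx x hx).1 ⟨i, rfl⟩)
  exact ⟨⟨P, by simpa using (Lob E F).add_mem hPi (f i).2⟩, hPx⟩

theorem Lob.isLUB_range_apply [Nonempty ι] {f : ι → Lob E F} {g : Lob E F}
    (hf : Directed (· ≤ ·) f) (hg : IsLUB (Set.range f) g) (hx : 0 ≤ x) :
    IsLUB (Set.range fun i => (f i).1 x) (g.1 x) := by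
  have hbdd (x : E) (hx : 0 ≤ x) : BddAbove (Set.range fun i => (f i).1 x) :=
    ⟨g.1 x, by rintro _ ⟨i, rfl⟩; exact hg.1 ⟨i, rfl⟩ x hx⟩
  obtain ⟨P, hP⟩ := Lob.exists_isLUB_apply hbdd fun x y hx hy i j => by
    obtain ⟨k, hik, hjk⟩ := hf i j
    calc (f i).1 x + (f j).1 y ≤ (f k).1 x + (f k).1 y := add_le_add (hik x hx) (hjk y hy)
      _ = (f k).1 (x + y) := (map_add _ x y).symm
      _ ≤ ⨆ k, (f k).1 (x + y) := le_ciSup (hbdd _ (add_nonneg hx hy)) k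
  have hgP : g ≤ P := hg.2 (by rintro _ ⟨i, rfl⟩ x hx; exact (hP x hx).1 ⟨i, rfl⟩)
  refine ⟨?_, fun c hc => (hgP x hx).trans ((hP x hx).2 hc)⟩
  rintro _ ⟨i, rfl⟩
  exact hg.1 ⟨i, rfl⟩ x hx

theorem Lob.isGLB_range_apply [Nonempty ι] {f : ι → Lob E F} {g : Lob E F}
    (hf : Directed (· ≥ ·) f) (hg : IsGLB (Set.range f) g) (hx : 0 ≤ x) :
    IsGLB (Set.range fun i => (f i).1 x) (g.1 x) := by
  have hneg : IsLUB (Set.range fun i => -f i) (-g) := by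
    have := hg.neg
    rwa [← Set.image_neg_eq_neg, ← Set.range_comp] at this
  have := (Lob.isLUB_range_apply (fun i j => (hf i j).imp fun _ h =>
    ⟨neg_le_neg h.1, neg_le_neg h.2⟩) hneg hx).neg
  rw [← Set.image_neg_eq_neg, ← Set.range_comp] at this
  simpa [Function.comp_def] using this

theorem Lob.orderTendsto_apply [Preorder ι] {T : ι → Lob E F} (h : OrderTendsto T 0) (x : E) :
    OrderTendsto (fun i => (T i).1 x) 0 := by
  obtain ⟨B, _, _, _, y, hy, hy0, hTy⟩ := orderTendsto_zero_iff.1 h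
  exact orderTendsto_zero_of_antitone (fun _ _ hbc => hy hbc |x| (abs_nonneg x))
    (Lob.isGLB_range_apply hy.directed_ge hy0 (abs_nonneg x)) fun b => (hTy b).imp fun _ hi₀ i hi =>
      (Lob.abs_apply_le (T i) x).trans (hi₀ i hi |x| (abs_nonneg x))

end RieszKantorovich

section OrthomorphismsAndBands

variable {E : Type u} [AddCommGroup E] [Lattice E] [IsOrderedAddMonoid E] [Module ℝ E]
  [IsOrderedModule ℝ E] {x u : E}

theorem Orth.mem_of_forall_nonneg {T : Lob E E}
    (h : ∀ B : Submodule ℝ E, IsBand B → ∀ x ∈ B, 0 ≤ x → T.1 x ∈ B) : T ∈ Orth E := by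
  intro B hB x hx
  rw [← posPart_sub_negPart x, map_sub]
  exact B.sub_mem (h B hB _ (hB.1.posPart_mem hx) (posPart_nonneg x))
    (h B hB _ (hB.1.negPart_mem hx) (negPart_nonneg x))

theorem Orth.mem_of_nonneg_of_le {P : Lob E E} {R : Orth E} (hP : 0 ≤ P) (hPR : P ≤ R) :
    P ∈ Orth E :=
  Orth.mem_of_forall_nonneg fun B hB x hx h0 =>
    hB.1.mem_of_nonneg_of_le (hP x h0) (hPR x h0) (R.2 B hB x hx)

theorem Orth.abs_apply_inf_abs_apply_eq_zero (S T : Orth E) (h : |x| ⊓ |u| = 0) :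
    |S.1.1 x| ⊓ |T.1.1 u| = 0 := by
  have hSx : S.1.1 x ∈ disjointComplement u := S.2 _ (isBand_disjointComplement u) x h
  have hu : u ∈ disjointComplement (S.1.1 x) := by rwa [mem_disjointComplement, inf_comm]
  rw [inf_comm]
  exact T.2 _ (isBand_disjointComplement _) u hu

theorem Orth.apply_add_inf_apply_add_le {S T : Orth E} (hS : 0 ≤ S) (hT : 0 ≤ T) {a b : E}
    (ha : 0 ≤ a) (hb : 0 ≤ b) :
    S.1.1 (a + b) ⊓ T.1.1 (a + b) ≤ (2 : ℝ) • (S.1.1 a + T.1.1 b) := by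
  -- Beyond their common part `m`, the elements `a` and `b` are disjoint, and so are their images.
  let m := a ⊓ b
  have ham : 0 ≤ a - m := sub_nonneg.2 inf_le_left
  have hbm : 0 ≤ b - m := sub_nonneg.2 inf_le_right
  have hdisj : S.1.1 (b - m) ⊓ T.1.1 (a - m) = 0 := by
    have := Orth.abs_apply_inf_abs_apply_eq_zero S T (x := b - m) (u := a - m) (by
      rw [abs_of_nonneg hbm, abs_of_nonneg ham, ← inf_sub, inf_comm, sub_self])
    rwa [abs_of_nonneg (hS _ hbm), abs_of_nonneg (hT _ ham)] at this
  have hsplit {R : Orth E} (hR : 0 ≤ R) {c d : E} (hmc : m ≤ c) :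
      R.1.1 (c + d) ≤ (2 : ℝ) • R.1.1 c + R.1.1 (d - m) := by
    have hmono : R.1.1 m ≤ R.1.1 c := Lob.monotone_of_nonneg hR hmc
    calc R.1.1 (c + d) = R.1.1 c + R.1.1 m + R.1.1 (d - m) := by
          rw [map_add, map_sub, add_assoc, add_sub_cancel]
      _ ≤ (2 : ℝ) • R.1.1 c + R.1.1 (d - m) := by
          rw [two_smul]
          gcongr
  calc S.1.1 (a + b) ⊓ T.1.1 (a + b)
      ≤ ((2 : ℝ) • S.1.1 a + S.1.1 (b - m)) ⊓ ((2 : ℝ) • T.1.1 b + T.1.1 (a - m)) :=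
        inf_le_inf (hsplit hS inf_le_left) (add_comm b a ▸ hsplit hT inf_le_right)
    _ ≤ ((2 : ℝ) • (S.1.1 a + T.1.1 b) + S.1.1 (b - m)) ⊓
          ((2 : ℝ) • (S.1.1 a + T.1.1 b) + T.1.1 (a - m)) := by
        gcongr
        · exact le_add_of_nonneg_right (hT b hb)
        · exact le_add_of_nonneg_left (hS a ha)
    _ = (2 : ℝ) • (S.1.1 a + T.1.1 b) := by rw [← add_inf, hdisj, add_zero]

end OrthomorphismsAndBands

section OrthomorphismLattice

variable {E : Type u} [AddCommGroup E] [ConditionallyCompleteLattice E] [IsOrderedAddMonoid E]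
  [Module ℝ E] [IsOrderedModule ℝ E] {x y : E}

theorem Orth.posPart_mem (T : Orth E) : T.1⁺ ∈ Orth E := by
  refine Orth.mem_of_forall_nonneg fun B hB x hx h0 =>
    hB.2 _ _ ?_ ((Set.nonempty_Icc.2 h0).image _) (Lob.isLUB_posPart_apply T.1 h0)
  rintro _ ⟨z, hz, rfl⟩
  exact T.2 B hB z (hB.1.mem_of_nonneg_of_le hz.1 hz.2 hx)

theorem Orth.coe_posPart (T : Orth E) : (T⁺).1 = T.1⁺ := by
  refine le_antisymm ?_ (sup_le (le_posPart T) (posPart_nonneg T))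
  have : T⁺ ≤ ⟨T.1⁺, Orth.posPart_mem T⟩ :=
    sup_le (show T.1 ≤ T.1⁺ from le_posPart _) (show 0 ≤ T.1⁺ from posPart_nonneg _)
  exact this

theorem Orth.coe_sup (S T : Orth E) : (S ⊔ T).1 = S.1 ⊔ T.1 := by
  rw [sup_eq_add_posPart_sub, sup_eq_add_posPart_sub, Submodule.coe_add, Orth.coe_posPart,
    Submodule.coe_sub]

theorem Orth.coe_abs (T : Orth E) : |T|.1 = |T.1| :=
  Orth.coe_sup T (-T)

theorem Orth.posPart_apply_inf_negPart_apply (T : Orth E) (hx : 0 ≤ x) :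
    (T⁺).1.1 x ⊓ (T⁻).1.1 x = 0 := by
  -- If `w` were not `0`, `hbound` would improve `T⁺ x` as an upper bound of `T '' [0, x]`.
  let w := (T⁺).1.1 x ⊓ (T⁻).1.1 x
  have hbound (z : E) (hz : z ∈ Set.Icc 0 x) :
      T.1.1 z ≤ (T⁺).1.1 x - (2⁻¹ : ℝ) • w := by
    have h := Orth.apply_add_inf_apply_add_le (posPart_nonneg T) (negPart_nonneg T)
      (sub_nonneg.2 hz.2) hz.1
    rw [sub_add_cancel, ← inv_smul_le_iff_of_pos two_pos, map_sub] at h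
    have hT : T.1.1 z = (T⁺).1.1 z - (T⁻).1.1 z := by
      conv_lhs => rw [← posPart_sub_negPart T]
      rfl
    rw [hT, le_sub_comm]
    exact h.trans_eq (by abel)
  have hw : (2⁻¹ : ℝ) • w ≤ 0 := by
    rw [← le_sub_self_iff ((T⁺).1.1 x), Orth.coe_posPart]
    refine (Lob.isLUB_posPart_apply T.1 hx).2 ?_
    rintro _ ⟨z, hz, rfl⟩
    rw [← Orth.coe_posPart]
    exact hbound z hz
  refine le_antisymm ?_ (le_inf (posPart_nonneg T x hx) (negPart_nonneg T x hx))
  rwa [inv_smul_le_iff_of_pos two_pos, smul_zero] at hw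

theorem Orth.posPart_apply (T : Orth E) (hx : 0 ≤ x) : (T⁺).1.1 x = (T.1.1 x)⁺ := by
  conv_rhs => rw [← posPart_sub_negPart T]
  exact (posPart_sub_eq_of_inf_eq_zero (Orth.posPart_apply_inf_negPart_apply T hx)).symm

theorem Orth.sup_apply (S T : Orth E) (hx : 0 ≤ x) : (S ⊔ T).1.1 x = S.1.1 x ⊔ T.1.1 x := by
  rw [sup_eq_add_posPart_sub, sup_eq_add_posPart_sub]
  exact congrArg (T.1.1 x + ·) (Orth.posPart_apply (S - T) hx)

theorem Orth.abs_apply (T : Orth E) (hx : 0 ≤ x) : |T|.1.1 x = |T.1.1 x| :=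
  Orth.sup_apply T (-T) hx

theorem Orth.abs_apply_abs (T : Orth E) (x : E) : |T|.1.1 |x| = |T.1.1 x| := by
  have hdisj : |T.1.1 x⁺| ⊓ |T.1.1 x⁻| = 0 := by
    refine Orth.abs_apply_inf_abs_apply_eq_zero T T ?_
    rw [abs_of_nonneg (posPart_nonneg x), abs_of_nonneg (negPart_nonneg x),
      posPart_inf_negPart_eq_zero]
  calc |T|.1.1 |x| = |T.1.1 x⁺| + |T.1.1 x⁻| := by
        rw [← posPart_add_negPart x, map_add, Orth.abs_apply T (posPart_nonneg x),
          Orth.abs_apply T (negPart_nonneg x)]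
    _ = |T.1.1 x⁺ - T.1.1 x⁻| := (abs_sub_eq_add_of_abs_inf_abs_eq_zero hdisj).symm
    _ = |T.1.1 x| := by rw [← map_sub, posPart_sub_negPart]

theorem Orth.abs_apply_le_abs_apply (T : Orth E) (h : |x| ≤ |y|) : |T.1.1 x| ≤ |T.1.1 y| := by
  rw [← Orth.abs_apply_abs, ← Orth.abs_apply_abs]
  exact Lob.monotone_of_nonneg (abs_nonneg T) h

end OrthomorphismLattice

section OrderConvergenceOfOrthomorphisms

variable {E : Type u} [AddCommGroup E] [ConditionallyCompleteLattice E] [IsOrderedAddMonoid E]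
  [Module ℝ E] [IsOrderedModule ℝ E] {ι : Type v}

theorem Orth.isGLB_range_coe [Nonempty ι] {f : ι → Orth E} (hf : IsGLB (Set.range f) 0) :
    IsGLB (Set.range fun i => (f i : Lob E E)) 0 := by
  refine ⟨?_, fun R hR => ?_⟩
  · rintro _ ⟨i, rfl⟩
    exact hf.1 ⟨i, rfl⟩
  · have hRf (i : ι) : R⁺ ≤ (f i : Lob E E) := sup_le (hR ⟨i, rfl⟩) (hf.1 ⟨i, rfl⟩)
    have hRO : R⁺ ∈ Orth E :=
      Orth.mem_of_nonneg_of_le (posPart_nonneg R) (hRf (Classical.arbitrary ι))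
    have hR0 : (⟨R⁺, hRO⟩ : Orth E) ≤ 0 := hf.2 (by rintro _ ⟨i, rfl⟩; exact hRf i)
    exact (le_posPart R).trans hR0

theorem Orth.orderTendsto_coe [Preorder ι] {T : ι → Orth E} (h : OrderTendsto T 0) :
    OrderTendsto (fun i => (T i : Lob E E)) 0 := by
  obtain ⟨B, _, _, _, y, hy, hy0, hTy⟩ := orderTendsto_zero_iff.1 h
  exact orderTendsto_zero_of_antitone hy (Orth.isGLB_range_coe hy0) fun b =>
    (hTy b).imp fun _ hi₀ i hi => (Orth.coe_abs (T i)).ge.trans (hi₀ i hi)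

theorem Orth.isIdeal_nullSubmodule [Preorder ι] [IsDirectedOrder ι] [Nonempty ι]
    (T : ι → Orth E) : IsIdeal (nullSubmodule fun i => (T i).1.1) :=
  fun _ _ hxy hy => mem_nullSubmodule.2 <|
    (mem_nullSubmodule.1 hy).of_abs_le_abs fun i => Orth.abs_apply_le_abs_apply (T i) hxy

theorem Orth.orderTendsto_apply_of_idealSpan_eq_top [Preorder ι] [IsDirectedOrder ι] [Nonempty ι]
    {T : ι → Orth E} {S : Set E} (hS : idealSpan S = ⊤)
    (h : ∀ s ∈ S, OrderTendsto (fun i => (T i).1.1 s) 0) (x : E) :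
    OrderTendsto (fun i => (T i).1.1 x) 0 :=
  mem_nullSubmodule.1 ((Orth.isIdeal_nullSubmodule T).idealSpan_le h (hS ▸ Submodule.mem_top))

theorem Orth.exists_isLUB_apply [Nonempty ι] {f : ι → Orth E}
    (hbdd : ∀ x, 0 ≤ x → BddAbove (Set.range fun i => (f i).1.1 x)) :
    ∃ P : Orth E, ∀ x, 0 ≤ x → IsLUB (Set.range fun i => (f i).1.1 x) (P.1.1 x) := by
  obtain ⟨P, hP⟩ := Lob.exists_isLUB_apply hbdd fun x y hx hy i j => by
    have hxy := add_nonneg hx hy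
    calc (f i).1.1 x + (f j).1.1 y ≤ (f i ⊔ f j).1.1 x + (f i ⊔ f j).1.1 y :=
          add_le_add ((le_sup_left : f i ≤ f i ⊔ f j) x hx)
            ((le_sup_right : f j ≤ f i ⊔ f j) y hy)
      _ = (f i).1.1 (x + y) ⊔ (f j).1.1 (x + y) := by
          rw [← map_add, Orth.sup_apply _ _ hxy]
      _ ≤ ⨆ k, (f k).1.1 (x + y) := sup_le (le_ciSup (hbdd _ hxy) i) (le_ciSup (hbdd _ hxy) j)
  have hPO : P ∈ Orth E := Orth.mem_of_forall_nonneg fun B hB x hx h0 => by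
    refine hB.2 _ _ ?_ (Set.range_nonempty _) (hP x h0)
    rintro _ ⟨i, rfl⟩
    exact (f i).2 B hB x hx
  exact ⟨⟨P, hPO⟩, hP⟩

theorem Orth.exists_isLUB_abs_apply_Ici [Preorder ι] {T : ι → Orth E}
    (hbdd : ∀ x, 0 ≤ x → BddAbove (Set.range fun i => |(T i).1.1 x|)) (i : ι) :
    ∃ Y : Orth E, ∀ x, 0 ≤ x → IsLUB ((fun j => |(T j).1.1 x|) '' Set.Ici i) (Y.1.1 x) := by
  obtain ⟨Y, hY⟩ := Orth.exists_isLUB_apply (f := fun j : Set.Ici i => |T j|) fun x hx =>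
    (hbdd x hx).mono (by rintro _ ⟨j, rfl⟩; exact ⟨j, (Orth.abs_apply (T j) hx).symm⟩)
  refine ⟨Y, fun x hx => ?_⟩
  rw [Set.image_eq_range]
  simpa only [Orth.abs_apply _ hx] using hY x hx

theorem Orth.orderTendsto_of_apply [Preorder ι] [IsDirectedOrder ι] [Nonempty ι] {T : ι → Orth E}
    (hbdd : ∀ x, 0 ≤ x → BddAbove (Set.range fun i => |(T i).1.1 x|))
    (h : ∀ x, 0 ≤ x → OrderTendsto (fun i => (T i).1.1 x) 0) : OrderTendsto T 0 := by
  choose Y hY using Orth.exists_isLUB_abs_apply_Ici hbdd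
  have hY_anti : Antitone Y := fun i j hij x hx =>
    (hY j x hx).mono (hY i x hx) (Set.image_mono (Set.Ici_subset_Ici.2 hij))
  have hTY {i j : ι} (hij : i ≤ j) : |T j| ≤ Y i := fun x hx =>
    (Orth.abs_apply (T j) hx).trans_le ((hY i x hx).1 ⟨j, hij, rfl⟩)
  have hY_glb : IsGLB (Set.range Y) 0 := by
    refine ⟨?_, fun R hR x hx => ?_⟩
    · rintro _ ⟨i, rfl⟩
      exact (abs_nonneg (T i)).trans (hTY le_rfl)
    · obtain ⟨B, _, _, _, y, -, hy0, hTy⟩ := orderTendsto_zero_iff.1 (h x hx)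
      refine hy0.2 ?_
      rintro _ ⟨b, rfl⟩
      obtain ⟨i, hi⟩ := hTy b
      refine (hR ⟨i, rfl⟩ x hx).trans ((hY i x hx).2 ?_)
      rintro _ ⟨j, hij, rfl⟩
      exact hi j hij
  exact orderTendsto_zero_of_antitone hY_anti hY_glb fun i => ⟨i, fun _ => hTY⟩

end OrderConvergenceOfOrthomorphisms

end VectorLattice

theorem mainTheorem5 {E : Type*} [AddCommGroup E] [ConditionallyCompleteLattice E]
    [IsOrderedAddMonoid E] [Module ℝ E] [IsOrderedModule ℝ E]
    (T : ℕ → VectorLattice.Orth E) :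
    (∀ S : Set E, S.Nonempty → VectorLattice.idealSpan S = ⊤ →
      List.TFAE [
        VectorLattice.OrderTendsto T 0,
        VectorLattice.OrderTendsto (fun n => (T n : VectorLattice.Lob E E)) 0,
        ∀ s ∈ S, VectorLattice.OrderTendsto (fun n => (T n : VectorLattice.Lob E E).1 s) 0,
        ∀ x : E, VectorLattice.OrderTendsto (fun n => (T n : VectorLattice.Lob E E).1 x) 0]) ∧
    (∀ e : E, VectorLattice.IsStrongOrderUnit e →
      (VectorLattice.OrderTendsto T 0 ↔
        VectorLattice.OrderTendsto (fun n => (T n : VectorLattice.Lob E E).1 e) 0)) := by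
  have of_apply (h : ∀ x, VectorLattice.OrderTendsto (fun n => (T n).1.1 x) 0) :
      VectorLattice.OrderTendsto T 0 :=
    VectorLattice.Orth.orderTendsto_of_apply (fun x _ => (h x).bddAbove_range_abs) fun x _ => h x
  refine ⟨fun S _ hS => ?_, fun e he => ⟨fun h => ?_, fun h => of_apply ?_⟩⟩
  · tfae_have 1 → 2 := VectorLattice.Orth.orderTendsto_coe
    tfae_have 2 → 4 := VectorLattice.Lob.orderTendsto_apply
    tfae_have 4 → 3 := fun h s _ => h s
    tfae_have 3 → 4 := VectorLattice.Orth.orderTendsto_apply_of_idealSpan_eq_top hS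
    tfae_have 4 → 1 := of_apply
    tfae_finish
  · exact VectorLattice.Lob.orderTendsto_apply (VectorLattice.Orth.orderTendsto_coe h) e
  · exact VectorLattice.Orth.orderTendsto_apply_of_idealSpan_eq_top he.idealSpan_eq_top (by simpa)
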